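/- Let $s\ge 1$ and $N\ge 2$ be integers, let $\gamma_1,\dots,\gamma_s>0$, and let $B_1(z)=z-\tfrac12$ and $B_2(z)=z^2-z+\tfrac16$. For $1\le d\le s$ let $\mathcal H_d$ be the unanchored Sobolev space of smoothness $1$ on $[0,1]^d$, that is, the reproducing kernel Hilbert space with reproducing kernel $$K^{\rm sob}_{1,\boldsymbol\gamma,d}(\boldsymbol x,\boldsymbol y)=\prod_{j=1}^d\Big(1+\gamma_jB_1(x_j)B_1(y_j)+\gamma_j\frac{B_2(|x_j-y_j|)}{2}\Big).$$ Let $\phi(x)=1-|2x-1|$ be the tent transformation. It is applied componentwise to vectors in $[0,1]^d$, and $\{\cdot\}$ denotes the componentwise fractional part. For $\boldsymbol g\in\{1,\dots,N-1\}^d$ let $$e_d(\boldsymbol g)=\sup_{f\in\mathcal H_d,\ \|f\|\le 1}\Big|\int_{[0,1]^d}f(\boldsymbol x)\,\mathrm d\boldsymbol x-\frac1N\sum_{n=0}^{N-1}f\big(\phi(\{n\boldsymbol g/N\})\big)\Big|$$ be the worst-case error in $\mathcal H_d$ of the (deterministic, unshifted) tent-transformed lattice rule with generating vector $\boldsymbol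 g$. The component-by-component (CBC) algorithm selects, for $d=1,\dots,s$ in turn and with $g_1,\dots,g_{d-1}$ kept fixed, a component $g_d\in\{1,\dots,N-1\}$ for which $e_d(g_1,\dots,g_d)$ is minimal (ties are broken arbitrarily). Then the CBC algorithm yields a vector $\boldsymbol g\in\{1,\dots,N-1\}^s$, and every vector $\boldsymbol g$ that it can yield satisfies, simultaneously for all real $\tau$ with $1\le\tau<2$, $$e_s(\boldsymbol g)\le C_{1,\boldsymbol\gamma,s,\tau}\,(N-1)^{-\tau/2},$$ where, with $\zeta$ the Riemann zeta function and $\gamma_{\mathfrak u}=\prod_{j\in\mathfrak u}\gamma_j$, $$C_{1,\boldsymbol\gamma,s,\tau}=\Big(\sum_{\emptyset\ne\mathfrak u\subseteq\{1,\dots,s\}}\gamma_{\mathfrak u}^{1/\tau}\,(2\zeta(2/\tau))^{|\mathfrak u|}\Big)^{\tau/2}=\Big(-1+\prod_{j=1}^s\big(1+2\zeta(2/\tau)\,\gamma_j^{1/\tau}\big)\Big)^{\tau/2}.$$ -/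

import Mathlib

open MeasureTheory
open scoped NNReal ENNReal unitInterval

namespace TentLattice

/-! ### Reproducing kernels and the unanchored Sobolev space of smoothness 1 -/

/-- The one-dimensional kernel `1 + γ B₁(x) B₁(y) + γ B₂(|x - y|) / 2` on `[0,1]`, where `B₁`, `B₂`
are the Bernoulli polynomials. -/
noncomputable def sobKernelOne (γ : ℝ≥0) : Matrix I I ℝ := Matrix.of fun x y =>
  1 + γ * (bernoulliFun 1 x * bernoulliFun 1 y) + γ * (bernoulliFun 2 |(x : ℝ) - y| / 2)

/-- The product kernel `∏ⱼ K_{γⱼ}(xⱼ, yⱼ)` on `[0,1]^s`. -/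
noncomputable def sobKernel {s : ℕ} (γ : Fin s → ℝ≥0) : Matrix (Fin s → I) (Fin s → I) ℝ :=
  Matrix.of fun x y => ∏ j, sobKernelOne (γ j) (x j) (y j)

/-- A real-valued kernel, seen as a kernel whose values are operators `ℝ → ℝ`
(the operator is multiplication by the value); this is the shape of kernels in `RKHS`. -/
noncomputable def toOperatorKernel {X : Type*} (K : Matrix X X ℝ) : Matrix X X (ℝ →L[ℝ] ℝ) :=
  Matrix.of fun x y => K x y • ContinuousLinearMap.id ℝ ℝ

theorem posSemidef_toOperatorKernel {X : Type*} {K : Matrix X X ℝ} (hK : K.PosSemidef) :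
    (toOperatorKernel K).PosSemidef := by
  have tf := (RKHS.posSemidef_tfae (𝕜 := ℝ) (K := toOperatorKernel K)).out 0 2
  refine tf.mpr ⟨?_, fun v => ?_⟩
  · ext x y
    have h := hK.isHermitian.apply x y
    simp only [star_trivial] at h
    have hid : star (ContinuousLinearMap.id ℝ ℝ) = ContinuousLinearMap.id ℝ ℝ := star_one _
    simp [toOperatorKernel, Matrix.conjTranspose_apply, h, hid]
  · have h := hK.2 v
    simp only [star_trivial] at h
    simp only [toOperatorKernel, RCLike.re_to_real]
    refine h.trans_eq ?_
    refine Finset.sum_congr rfl fun x _ => Finset.sum_congr rfl fun y _ => ?_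
    have h2 := hK.isHermitian.apply x y
    simp only [star_trivial] at h2
    simp [h2]
    ring

theorem posSemidef_of_feature {X : Type*} (φ : X → ℝ) :
    Matrix.PosSemidef (Matrix.of fun x y => φ x * φ y : Matrix X X ℝ) := by
  refine ⟨by ext x y; simp [Matrix.conjTranspose_apply, mul_comm], fun v => ?_⟩
  have : (v.sum fun i a => v.sum fun j b => star a * (Matrix.of (fun x y => φ x * φ y) i j) * b) =
      (v.sum fun i a => a * φ i) ^ 2 := by
    simp only [Finsupp.sum, sq, Finset.sum_mul_sum, star_trivial, Matrix.of_apply]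
    exact Finset.sum_congr rfl fun x _ => Finset.sum_congr rfl fun y _ => by ring
  rw [this]
  positivity

theorem posSemidef_of_hasSum {X : Type*} {F : ℕ → Matrix X X ℝ} {K : Matrix X X ℝ}
    (hF : ∀ n, (F n).PosSemidef) (h : ∀ x y, HasSum (fun n => F n x y) (K x y)) :
    K.PosSemidef := by
  refine ⟨?_, fun v => ?_⟩
  · ext x y
    have h1 := h y x
    have h2 : (fun n => F n y x) = fun n => F n x y := by
      funext n
      simpa using (hF n).isHermitian.apply x y
    rw [h2] at h1
    simpa [Matrix.conjTranspose_apply] using h1.unique (h x y)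
  · have key : HasSum (fun n => v.sum fun i a => v.sum fun j b => star a * F n i j * b)
        (v.sum fun i a => v.sum fun j b => star a * K i j * b) :=
      hasSum_sum fun i _ => hasSum_sum fun j _ => ((h i j).mul_left _).mul_right _
    exact key.nonneg fun n => (hF n).2 v

theorem hasSum_sobKernelOne (γ : ℝ≥0) (x y : I) :
    HasSum (fun n : ℕ => (γ / Real.pi ^ 2 * (2 / (n : ℝ) ^ 2)) *
      (Real.cos (Real.pi * n * x) * Real.cos (Real.pi * n * y)))
      (sobKernelOne γ x y - 1) := by
  obtain ⟨hx0, hx1⟩ := x.2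
  obtain ⟨hy0, hy1⟩ := y.2
  simp only [sobKernelOne, Matrix.of_apply, bernoulliFun_one, bernoulliFun_two]
  generalize (x : ℝ) = x at *
  generalize (y : ℝ) = y at *
  have hu : |x - y| / 2 ∈ Set.Icc (0 : ℝ) 1 := by
    refine ⟨by positivity, ?_⟩
    have : |x - y| ≤ 1 := abs_le.2 ⟨by linarith, by linarith⟩
    linarith
  have hv : (x + y) / 2 ∈ Set.Icc (0 : ℝ) 1 := ⟨by linarith, by linarith⟩
  have h1 := hasSum_one_div_nat_pow_mul_cos one_ne_zero hu
  have h2 := hasSum_one_div_nat_pow_mul_cos one_ne_zero hv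
  have h := (h1.add h2).mul_left (γ / Real.pi ^ 2)
  have hb : ∀ z : ℝ, (Polynomial.map (algebraMap ℚ ℝ) (Polynomial.bernoulli (2 * 1))).eval z
      = z ^ 2 - z + 6⁻¹ := fun z => bernoulliFun_two z
  have hpi : Real.pi ≠ 0 := Real.pi_ne_zero
  convert! h using 1
  · funext n
    have hc : Real.cos (2 * Real.pi * n * (|x - y| / 2)) = Real.cos (Real.pi * n * x - Real.pi * n * y) := by
      rcases abs_cases (x - y) with ⟨h, _⟩ | ⟨h, _⟩
      · rw [h]; congr 1; ring
      · rw [h, ← Real.cos_neg]; congr 1; ring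
    have hd : Real.cos (2 * Real.pi * n * ((x + y) / 2)) = Real.cos (Real.pi * n * x + Real.pi * n * y) := by
      congr 1; ring
    rw [hc, hd, Real.cos_sub, Real.cos_add]
    simp only [mul_one]
    ring
  · rw [hb, hb]
    have hsq : |x - y| ^ 2 = (x - y) ^ 2 := sq_abs _
    norm_num [Nat.factorial]
    field_simp
    ring_nf
    have hsq' : |x - y| ^ 2 = x ^ 2 - 2 * x * y + y ^ 2 := by rw [hsq]; ring
    rw [hsq']
    ring

theorem posSemidef_sobKernelOne (γ : ℝ≥0) : (sobKernelOne γ).PosSemidef := by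
  have h1 : Matrix.PosSemidef (Matrix.of fun _ _ => 1 : Matrix I I ℝ) := by
    simpa using posSemidef_of_feature (fun _ : I => (1 : ℝ))
  have h2 : Matrix.PosSemidef (Matrix.of fun x y => sobKernelOne γ x y - 1 : Matrix I I ℝ) := by
    refine posSemidef_of_hasSum (F := fun n : ℕ => (γ / Real.pi ^ 2 * (2 / (n : ℝ) ^ 2)) •
      (Matrix.of fun x y => Real.cos (Real.pi * n * x) * Real.cos (Real.pi * n * y) : Matrix I I ℝ))
      (fun n => ?_) (fun x y => ?_)
    · exact (posSemidef_of_feature fun x : I => Real.cos (Real.pi * n * x)).smul (by positivity)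
    · exact hasSum_sobKernelOne γ x y
  refine (congrArg Matrix.PosSemidef ?_).mpr (h1.add h2)
  ext x y
  simp

theorem posSemidef_sobKernel {s : ℕ} (γ : Fin s → ℝ≥0) : (sobKernel γ).PosSemidef := by
  have key : ∀ t : Finset (Fin s), Matrix.PosSemidef
      (Matrix.of fun x y => ∏ j ∈ t, sobKernelOne (γ j) (x j) (y j) : Matrix (Fin s → I) (Fin s → I) ℝ) := by
    intro t
    induction t using Finset.induction_on with
    | empty => simpa using posSemidef_of_feature (fun _ : Fin s → I => (1 : ℝ))
    | insert j t hj ih =>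
      have h := ((posSemidef_sobKernelOne (γ j)).submatrix (fun x : Fin s → I => x j)).hadamard ih
      refine (congrArg Matrix.PosSemidef ?_).mpr h
      ext x y
      simp [Finset.prod_insert hj, Matrix.hadamard_apply]
  exact key Finset.univ

instance factPosSemidefSobKernel {s : ℕ} (γ : Fin s → ℝ≥0) :
    Fact (toOperatorKernel (sobKernel γ)).PosSemidef :=
  ⟨posSemidef_toOperatorKernel (posSemidef_sobKernel γ)⟩

/-- The unanchored Sobolev space of smoothness 1 on `[0,1]^s` with weights `γ`: the reproducing
kernel Hilbert space with kernel `sobKernel γ`. -/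
abbrev SobolevSpace {s : ℕ} (γ : Fin s → ℝ≥0) : Type :=
  RKHS.OfKernel (toOperatorKernel (sobKernel γ))

/-! ### Quasi-Monte Carlo integration -/

/-- Worst-case error of the equal-weight rule with nodes `P 0, …, P (N - 1)` (repetitions counted)
in a reproducing kernel Hilbert space `H` of functions on `[0,1]^s`: the supremum, over the unit
ball of `H`, of the integration error. It is taken in `[0,∞]`, so that it is a true supremum. -/
noncomputable def worstCaseError {s N : ℕ} (H : Type*) [NormedAddCommGroup H]
    [InnerProductSpace ℝ H] [RKHS ℝ H (Fin s → I) ℝ] (P : Fin N → Fin s → I) : ℝ≥0∞ :=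
  ⨆ f : H, ⨆ _ : ‖f‖ ≤ 1,
    ENNReal.ofReal |(∫ x : Fin s → I, f x) - (1 / (N : ℝ)) * ∑ n : Fin N, f (P n)|

/-- The tent transformation `φ(x) = 1 - |2x - 1|`. -/
noncomputable def tent (x : I) : I :=
  ⟨1 - |2 * (x : ℝ) - 1|, by
    have h : |2 * (x : ℝ) - 1| ≤ 1 := abs_le.2 ⟨by linarith [x.2.1], by linarith [x.2.2]⟩
    exact ⟨by linarith, by linarith [abs_nonneg (2 * (x : ℝ) - 1)]⟩⟩

/-- The points `{n g / N}`, `0 ≤ n < N`, of the lattice rule with generating vector `g`. -/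
noncomputable def latticePoint {s : ℕ} (N : ℕ) (g : Fin s → ℕ) (n : Fin N) : Fin s → I :=
  fun j => ⟨Int.fract (((n : ℕ) : ℝ) * (g j : ℝ) / (N : ℝ)),
    Int.fract_nonneg _, (Int.fract_lt_one _).le⟩

/-- The points `φ({n g / N})`, `0 ≤ n < N`, of the tent-transformed lattice rule. -/
noncomputable def tentLatticePoint {s : ℕ} (N : ℕ) (g : Fin s → ℕ) (n : Fin N) : Fin s → I :=
  fun j => tent (latticePoint N g n j)

/-! ### Component-by-component construction -/

/-- The worst-case error in the Sobolev space of the tent-transformed lattice rule. -/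
noncomputable def sobError {s : ℕ} (N : ℕ) (γ : Fin s → ℝ≥0) (g : Fin s → ℕ) : ℝ≥0∞ :=
  worstCaseError (SobolevSpace γ) (tentLatticePoint N g)

/-- The first `d` entries of a vector of length `s ≥ d`. -/
def initial {α : Type*} {s d : ℕ} (hd : d ≤ s) (v : Fin s → α) : Fin d → α :=
  fun i => v (Fin.castLE hd i)

/-- `g` is an output of the component-by-component algorithm with `N` points and weights `γ`:
the components lie in `{1, …, N - 1}` and, for `d = 0, 1, …, s - 1` in turn, with the first `d`
components kept fixed, the next component is chosen in `{1, …, N - 1}` so that it minimizes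
the `(d + 1)`-dimensional worst-case error. Ties may be broken in any way. -/
def IsCBCVector {s : ℕ} (N : ℕ) (γ : Fin s → ℝ≥0) (g : Fin s → ℕ) : Prop :=
  (∀ j, g j ∈ Finset.Icc 1 (N - 1)) ∧
  ∀ (d : ℕ) (hd : d + 1 ≤ s), ∀ z ∈ Finset.Icc 1 (N - 1),
    sobError N (initial hd γ) (initial hd g) ≤
      sobError N (initial hd γ) (Function.update (initial hd g) (Fin.last d) z)

/-- The constant `C_{1,γ,s,τ} = (∑_{∅ ≠ u ⊆ [s]} γ_u^{1/τ} (2 ζ(2/τ))^{|u|})^{τ/2}`, with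
`γ_u = ∏_{j ∈ u} γ_j`. -/
noncomputable def cbcConst {s : ℕ} (γ : Fin s → ℝ≥0) (τ : ℝ) : ℝ :=
  (∑ u ∈ (Finset.univ : Finset (Finset (Fin s))).erase ∅,
    (∏ j ∈ u, (γ j : ℝ)) ^ (1 / τ) * (2 * (riemannZeta ((2 / τ : ℝ) : ℂ)).re) ^ u.card) ^ (τ / 2)

end TentLattice

namespace TentLattice

/-! ### Weights on `{1, …, N - 1}` that equidistribute multiplication -/

/-! Put p = 1/τ, so that 1/2 < p ≤ 1, and α = 2p > 1. The squared worst-case error is Q_d(1) - 1,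
where Q_d is the quadratic form `kerForm` of the kernel at the nodes in dimension d. The
one-dimensional kernel minus 1 is a cosine series in cos(πkx) cos(πky) with coefficients at most
γ/k², and the tent map turns cos(πkx) at a node into cos(2πkgn/N). Hence Q_{d+1}(u) is Q_d(u) plus a
non-negative series of values of Q_d at u times cosine vectors (`hasSum_kerForm_succ`).

For u = 1, a candidate component z adds the terms c_k Q_d(cosVec(kz)). Taking p-th powers termwise
and averaging over z bounds the minimum. Any weights on z are allowed in this average. For composite
N equal weights may overload a residue (N = 6, residue 0, α near 1), so
`exists_equidistributing_weights` takes weights of total mass at least N - 1 under which each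
residue receives at most ζ(α). One step thus adds at most ζ(2p) γ^p S_d / (N - 1) to the p-th power
of the squared error, where S_d is the sum of Q_d(cosVec b)^p over all b (`error_step_le`).

For u = cosVec b, the product-to-sum formula shows that S_d grows by a factor of at most 1 +
2ζ(2p)γ^p (`cosPowerSum_succ_le`). Induction on d combines the two bounds (`IsCBCVector.error_le`).
The parameter p enters only the analysis and not the choice of the vector, so one vector serves all
τ. -/

theorem sum_range_mul_of_periodic {f : ℕ → ℝ} {M : ℕ} (hf : ∀ x, f (x + M) = f x) (d : ℕ) :
    ∑ x ∈ Finset.range (d * M), f x = d * ∑ x ∈ Finset.range M, f x := by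
  have hf' : ∀ d x, f (d * M + x) = f x := by
    intro d
    induction d with
    | zero => intro x; simp
    | succ d ih =>
      intro x
      rw [show (d + 1) * M + x = (d * M + x) + M by ring, hf, ih]
  induction d with
  | zero => simp
  | succ d ih =>
    rw [add_mul, one_mul, Finset.sum_range_add, ih, Finset.sum_congr rfl fun x _ => hf' d x]
    push_cast
    ring

theorem sum_range_filter_dvd {d M : ℕ} (hd : 0 < d) (f : ℕ → ℝ) :
    ∑ x ∈ Finset.range (d * M) with d ∣ x, f x = ∑ x ∈ Finset.range M, f (d * x) := by
  symm
  refine Finset.sum_bij (fun x _ => d * x) ?_ ?_ ?_ ?_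
  · intro x hx
    simp only [Finset.mem_range] at hx
    simp [hx, hd]
  · intro x _ y _ h
    exact Nat.eq_of_mul_eq_mul_left hd h
  · intro y hy
    simp only [Finset.mem_filter, Finset.mem_range] at hy
    obtain ⟨hy, x, rfl⟩ := hy
    exact ⟨x, by simpa using lt_of_mul_lt_mul_left hy (Nat.zero_le d), rfl⟩
  · intro _ _
    rfl

/-- Number of residues `w` modulo `N` with `m w = a`. -/
noncomputable def solutionCount (N : ℕ) (a : ZMod N) (m : ℕ) : ℝ :=
  ∑ w ∈ Finset.range N, if ((m * w : ℕ) : ZMod N) = a then 1 else 0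

theorem solutionCount_nonneg (N : ℕ) (a : ZMod N) (m : ℕ) : 0 ≤ solutionCount N a m :=
  Finset.sum_nonneg fun _ _ => by split_ifs <;> norm_num

theorem solutionCount_le (N : ℕ) (a : ZMod N) (m : ℕ) : solutionCount N a m ≤ N := by
  refine (Finset.sum_le_sum (g := fun _ => (1 : ℝ)) fun _ _ => ?_).trans (by simp)
  split_ifs <;> norm_num

theorem solutionCount_le_one {N : ℕ} (a : ZMod N) {m : ℕ} (hm : m.Coprime N) :
    solutionCount N a m ≤ 1 := by
  rw [solutionCount, ← Finset.sum_filter, Finset.sum_const, nsmul_eq_mul, mul_one]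
  norm_cast
  refine Finset.card_le_one.2 fun x hx y hy => ?_
  simp only [Finset.mem_filter, Finset.mem_range] at hx hy
  have h := hx.2.trans hy.2.symm
  rw [ZMod.natCast_eq_natCast_iff] at h
  have h' : x ≡ y [MOD N] := Nat.ModEq.cancel_left_of_coprime hm.symm h
  exact h'.eq_of_lt_of_lt hx.1 hy.1

/-- For z = dw the condition depends only on w modulo N/d, and d periods of length N/d fill the full
range of residues. -/
theorem sum_multiples_solutions {N d : ℕ} (hd : d ∣ N) (hN : 0 < N) (a : ZMod N) (h : ℕ) :
    (d : ℝ) * ∑ z ∈ Finset.range N with d ∣ z, (if ((h * z : ℕ) : ZMod N) = a then (1 : ℝ) else 0) =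
      solutionCount N a (h * d) := by
  obtain ⟨M, rfl⟩ := hd
  have hd : 0 < d := Nat.pos_of_mul_pos_right hN
  rw [sum_range_filter_dvd hd, solutionCount, ← sum_range_mul_of_periodic]
  · simp only [mul_assoc]
  · intro x
    have : ((h * (d * (x + M)) : ℕ) : ZMod (d * M)) = ((h * (d * x) : ℕ) : ZMod (d * M)) := by
      rw [ZMod.natCast_eq_natCast_iff]
      rw [show h * (d * (x + M)) = h * (d * x) + d * M * h by ring]
      simp [Nat.ModEq]
    rw [this]

/-! ### Möbius sums over the divisors of the radical -/

/-- The arithmetic function `n ↦ n ^ t`. -/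
noncomputable def rpowArith (t : ℝ) : ArithmeticFunction ℝ :=
  ⟨fun n => if n = 0 then 0 else (n : ℝ) ^ t, by simp⟩

theorem rpowArith_apply (t : ℝ) {n : ℕ} (hn : n ≠ 0) : rpowArith t n = (n : ℝ) ^ t := by
  simp [rpowArith, hn]

theorem isMultiplicative_rpowArith (t : ℝ) : (rpowArith t).IsMultiplicative := by
  rw [ArithmeticFunction.IsMultiplicative.iff_ne_zero]
  refine ⟨by simp [rpowArith], fun {m n} hm hn _ => ?_⟩
  rw [rpowArith_apply _ hm, rpowArith_apply _ hn, rpowArith_apply _ (mul_ne_zero hm hn)]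
  push_cast
  exact Real.mul_rpow (by positivity) (by positivity)

theorem sum_moebius_mul_rpow {n : ℕ} (hn : Squarefree n) (t : ℝ) :
    ∑ d ∈ n.divisors, (ArithmeticFunction.moebius d : ℝ) * (d : ℝ) ^ t =
      ∏ p ∈ n.primeFactors, (1 - (p : ℝ) ^ t) := by
  have h := (isMultiplicative_rpowArith t).prodPrimeFactors_one_sub_of_squarefree _ hn
  rw [Finset.sum_congr rfl fun d hd => ?_, ← h, Finset.prod_congr rfl fun p hp => ?_]
  · rw [rpowArith_apply _ (Nat.prime_of_mem_primeFactors hp).ne_zero]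
  · rw [rpowArith_apply _ (Nat.pos_of_mem_divisors hd).ne']

theorem sum_moebius_divisors_gcd {m r : ℕ} (hr : r ≠ 0) :
    ∑ d ∈ r.divisors, (if d ∣ m then (ArithmeticFunction.moebius d : ℝ) else 0) =
      if m.Coprime r then 1 else 0 := by
  have h : (∑ d ∈ (m.gcd r).divisors, ArithmeticFunction.moebius d : ℤ) =
      if m.gcd r = 1 then 1 else 0 := by
    rw [← ArithmeticFunction.coe_mul_zeta_apply, ArithmeticFunction.moebius_mul_coe_zeta,
      ArithmeticFunction.one_apply]
  rw [← Finset.sum_filter]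
  have hs : (r.divisors.filter fun d => d ∣ m) = (m.gcd r).divisors := by
    ext d
    simp [Nat.dvd_gcd_iff, hr, and_comm]
  rw [hs]
  have h' := congrArg (Int.cast : ℤ → ℝ) h
  push_cast at h'
  rw [h']

theorem summable_rpow_mul_of_bounded {α : ℝ} (hα : 1 < α) {G : ℕ → ℝ} {C : ℝ}
    (hG0 : ∀ m, 0 ≤ G m) (hG : ∀ m, G m ≤ C) : Summable fun m : ℕ => (m : ℝ) ^ (-α) * G m := by
  have h := (Real.summable_nat_rpow.2 (show -α < -1 by linarith)).mul_right C
  refine h.of_nonneg_of_le (fun m => mul_nonneg (by positivity) (hG0 m)) fun m => ?_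
  exact mul_le_mul_of_nonneg_left (hG m) (by positivity)

/-- After the sums are exchanged, F(m) carries the sum of μ over the common divisors of m and r,
which detects coprimality. -/
theorem sum_moebius_tsum_multiples {r : ℕ} (hr : r ≠ 0) {F : ℕ → ℝ} (hF : Summable F) :
    ∑ d ∈ r.divisors, (ArithmeticFunction.moebius d : ℝ) * ∑' h : ℕ, F (h * d) =
      ∑' m : ℕ, if m.Coprime r then F m else 0 := by
  have h1 : ∀ d ∈ r.divisors, (ArithmeticFunction.moebius d : ℝ) * ∑' h : ℕ, F (h * d) =
      ∑' m : ℕ, (if d ∣ m then (ArithmeticFunction.moebius d : ℝ) else 0) * F m := by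
    intro d hd
    have hd0 : 0 < d := Nat.pos_of_mem_divisors hd
    have hinj : Function.Injective fun h : ℕ => h * d := fun x y h =>
      Nat.eq_of_mul_eq_mul_right hd0 h
    have h2 := hinj.tsum_eq (f := fun m => if d ∣ m then F m else 0) (by
      intro m hm
      simp only [Function.mem_support, ne_eq, ite_eq_right_iff, Classical.not_imp] at hm
      obtain ⟨k, rfl⟩ := hm.1
      exact ⟨k, mul_comm _ _⟩)
    simp only [dvd_mul_left, if_true] at h2
    rw [h2, ← tsum_mul_left]
    exact tsum_congr fun m => by split_ifs <;> simp
  rw [Finset.sum_congr rfl h1, ← Summable.tsum_finsetSum]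
  · refine tsum_congr fun m => ?_
    rw [← Finset.sum_mul, sum_moebius_divisors_gcd hr]
    split_ifs <;> simp
  · intro d _
    refine (hF.abs.mul_left |(ArithmeticFunction.moebius d : ℝ)|).of_norm_bounded fun m => ?_
    split_ifs <;> simp
    positivity

/-- The weight `∏ (1 - p ^ (1 - α))`, the product being over the primes dividing `z` and `N`. -/
noncomputable def divisorWeight (N : ℕ) (α : ℝ) (z : ℕ) : ℝ :=
  ∏ p ∈ (z.gcd (UniqueFactorizationMonoid.radical N)).primeFactors, (1 - (p : ℝ) ^ (1 - α))

/-- The Euler factor `∏_{p ∣ N} (1 - p ^ (-α))`. -/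
noncomputable def eulerFactor (N : ℕ) (α : ℝ) : ℝ :=
  ∏ p ∈ N.primeFactors, (1 - (p : ℝ) ^ (-α))

theorem one_sub_rpow_nonneg {t : ℝ} (ht : t ≤ 0) {p : ℕ} (hp : p.Prime) :
    0 ≤ 1 - (p : ℝ) ^ t := by
  have : (p : ℝ) ^ t ≤ 1 := Real.rpow_le_one_of_one_le_of_nonpos (mod_cast hp.one_lt.le) ht
  linarith

theorem divisorWeight_nonneg (N : ℕ) {α : ℝ} (hα : 1 < α) (z : ℕ) : 0 ≤ divisorWeight N α z :=
  Finset.prod_nonneg fun _ hp =>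
    one_sub_rpow_nonneg (by linarith) (Nat.prime_of_mem_primeFactors hp)

theorem eulerFactor_pos (N : ℕ) {α : ℝ} (hα : 1 < α) : 0 < eulerFactor N α := by
  refine Finset.prod_pos fun p hp => ?_
  have : (p : ℝ) ^ (-α) < 1 := Real.rpow_lt_one_of_one_lt_of_neg
    (mod_cast (Nat.prime_of_mem_primeFactors hp).one_lt) (by linarith)
  linarith

theorem primeFactors_radical (N : ℕ) :
    (UniqueFactorizationMonoid.radical N).primeFactors = N.primeFactors := by
  rw [Nat.radical_eq_prod_primeFactors]
  exact Nat.primeFactors_prod fun p hp => Nat.prime_of_mem_primeFactors hp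

/-- Bounds the mass lost when the inadmissible z = 0 is removed; the remaining mass is then at least
N - 1 Euler factors. -/
theorem divisorWeight_zero_le (N : ℕ) {α : ℝ} (hα : 1 < α) :
    divisorWeight N α 0 ≤ eulerFactor N α := by
  rw [divisorWeight, Nat.gcd_zero_left, primeFactors_radical, eulerFactor]
  refine Finset.prod_le_prod (fun p hp => one_sub_rpow_nonneg (by linarith)
    (Nat.prime_of_mem_primeFactors hp)) fun p hp => ?_
  have : (p : ℝ) ^ (-α) ≤ (p : ℝ) ^ (1 - α) := Real.rpow_le_rpow_of_exponent_le
    (mod_cast (Nat.prime_of_mem_primeFactors hp).one_lt.le) (by linarith)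
  linarith

/-- The gcd with the radical is squarefree, so the product defining the weight expands into the sum
of μ(d) d^(1-α) over its divisors d. -/
theorem sum_divisorWeight_mul {N : ℕ} (α : ℝ) (G : ℕ → ℝ) :
    ∑ z ∈ Finset.range N, divisorWeight N α z * G z =
      ∑ d ∈ (UniqueFactorizationMonoid.radical N).divisors,
        (ArithmeticFunction.moebius d : ℝ) * (d : ℝ) ^ (1 - α) *
          ∑ z ∈ Finset.range N with d ∣ z, G z := by
  set r := UniqueFactorizationMonoid.radical N
  have hr : Squarefree r := UniqueFactorizationMonoid.squarefree_radical
  have h1 : ∀ z, divisorWeight N α z = ∑ d ∈ r.divisors,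
      if d ∣ z then (ArithmeticFunction.moebius d : ℝ) * (d : ℝ) ^ (1 - α) else 0 := by
    intro z
    rw [divisorWeight, ← sum_moebius_mul_rpow (hr.squarefree_of_dvd (Nat.gcd_dvd_right z r)),
      ← Finset.sum_filter]
    refine Finset.sum_congr ?_ fun _ _ => rfl
    ext d
    simp [Nat.dvd_gcd_iff, hr.ne_zero, and_comm]
  simp only [h1, Finset.sum_mul, Finset.mul_sum]
  rw [Finset.sum_comm]
  refine Finset.sum_congr rfl fun d _ => ?_
  rw [Finset.sum_filter]
  exact Finset.sum_congr rfl fun z _ => by split_ifs <;> simp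

theorem sum_divisorWeight (N : ℕ) (α : ℝ) :
    ∑ z ∈ Finset.range N, divisorWeight N α z = N * eulerFactor N α := by
  have h := sum_divisorWeight_mul (N := N) α fun _ => 1
  simp only [mul_one] at h
  rw [h, eulerFactor, ← primeFactors_radical, ← sum_moebius_mul_rpow
    UniqueFactorizationMonoid.squarefree_radical, Finset.mul_sum]
  refine Finset.sum_congr rfl fun d hd => ?_
  have hd0 : 0 < d := Nat.pos_of_mem_divisors hd
  obtain ⟨M, hM⟩ : d ∣ N :=
    (Nat.dvd_of_mem_divisors hd).trans UniqueFactorizationMonoid.radical_dvd_self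
  have hs : ∑ z ∈ Finset.range N with d ∣ z, (1 : ℝ) = M := by
    rw [hM, sum_range_filter_dvd hd0]
    simp
  have hd1 : (0 : ℝ) < d := mod_cast hd0
  rw [hs, hM, show (1 - α) = 1 + (-α) by ring, Real.rpow_add hd1, Real.rpow_one]
  push_cast
  ring

theorem coprime_radical_iff {m N : ℕ} (hN : N ≠ 0) :
    m.Coprime (UniqueFactorizationMonoid.radical N) ↔ m.Coprime N := by
  constructor
  · intro h
    refine Nat.coprime_of_dvd fun p hp hpm hpN => ?_
    have : p ∈ (UniqueFactorizationMonoid.radical N).primeFactors := by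
      rw [primeFactors_radical]
      exact Nat.mem_primeFactors.2 ⟨hp, hpN, hN⟩
    exact Nat.not_coprime_of_dvd_of_dvd hp.one_lt hpm (Nat.dvd_of_mem_primeFactors this) h
  · exact fun h => h.coprime_dvd_right UniqueFactorizationMonoid.radical_dvd_self

theorem sum_moebius_tsum_rpow {N : ℕ} {α : ℝ} (hα : 1 < α) {G : ℕ → ℝ} {C : ℝ}
    (hG0 : ∀ m, 0 ≤ G m) (hG : ∀ m, G m ≤ C) (hN : N ≠ 0) :
    ∑ d ∈ (UniqueFactorizationMonoid.radical N).divisors,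
        (ArithmeticFunction.moebius d : ℝ) * (d : ℝ) ^ (-α) * ∑' h : ℕ, (h : ℝ) ^ (-α) * G (h * d) =
      ∑' m : ℕ, if m.Coprime N then (m : ℝ) ^ (-α) * G m else 0 := by
  have h := sum_moebius_tsum_multiples (r := UniqueFactorizationMonoid.radical N)
    UniqueFactorizationMonoid.radical_ne_zero (summable_rpow_mul_of_bounded hα hG0 hG)
  simp only [coprime_radical_iff hN] at h
  rw [← h]
  refine Finset.sum_congr rfl fun d _ => ?_
  rw [mul_assoc, ← tsum_mul_left]
  congr 1
  refine tsum_congr fun k => ?_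
  push_cast
  rw [Real.mul_rpow (by positivity) (by positivity)]
  ring

/-- Counting solutions among multiples of d costs a factor 1/d, which turns d^(1-α) into d^(-α);
this merges with h^(-α) into (hd)^(-α). The Möbius sum then leaves only m = hd coprime to N, and for
those mz = a has at most one solution. -/
theorem sum_divisorWeight_mul_tsum_le {N : ℕ} (hN : 0 < N) {α : ℝ} (hα : 1 < α) (a : ZMod N) :
    ∑ z ∈ Finset.range N, divisorWeight N α z *
        ∑' h : ℕ, (h : ℝ) ^ (-α) * (if ((h * z : ℕ) : ZMod N) = a then 1 else 0) ≤
      eulerFactor N α * ∑' h : ℕ, (h : ℝ) ^ (-α) := by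
  have hsum : ∀ z : ℕ, Summable fun h : ℕ =>
      (h : ℝ) ^ (-α) * (if ((h * z : ℕ) : ZMod N) = a then (1 : ℝ) else 0) := fun z =>
    summable_rpow_mul_of_bounded (C := 1) hα (fun m => by split_ifs <;> norm_num)
      (fun m => by split_ifs <;> norm_num)
  rw [sum_divisorWeight_mul]
  have h1 : ∀ d ∈ (UniqueFactorizationMonoid.radical N).divisors,
      (ArithmeticFunction.moebius d : ℝ) * (d : ℝ) ^ (1 - α) *
        ∑ z ∈ Finset.range N with d ∣ z,
          ∑' h : ℕ, (h : ℝ) ^ (-α) * (if ((h * z : ℕ) : ZMod N) = a then (1 : ℝ) else 0) =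
      (ArithmeticFunction.moebius d : ℝ) * (d : ℝ) ^ (-α) *
        ∑' h : ℕ, (h : ℝ) ^ (-α) * solutionCount N a (h * d) := by
    intro d hd
    have hd0 : (0 : ℝ) < d := mod_cast Nat.pos_of_mem_divisors hd
    have hdN : d ∣ N :=
      (Nat.dvd_of_mem_divisors hd).trans UniqueFactorizationMonoid.radical_dvd_self
    rw [← Summable.tsum_finsetSum fun z _ => hsum z, show (1 - α) = (-α) + 1 by ring,
      Real.rpow_add hd0, Real.rpow_one, ← mul_assoc, mul_assoc (_ * _), ← tsum_mul_left]
    congr 1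
    refine tsum_congr fun h => ?_
    rw [← sum_multiples_solutions hdN hN, Finset.mul_sum, Finset.mul_sum, Finset.mul_sum]
    exact Finset.sum_congr rfl fun z _ => by ring
  rw [Finset.sum_congr rfl h1, sum_moebius_tsum_rpow hα (solutionCount_nonneg N a)
    (solutionCount_le N a) hN.ne']
  -- The same identity with every count replaced by 1 evaluates the coprime part of the zeta series
  -- as the Euler factor times the whole series.
  have h2 := sum_moebius_tsum_rpow (N := N) (G := fun _ => 1) hα (fun _ => zero_le_one)
    (fun _ => le_refl (1 : ℝ)) hN.ne'
  simp only [mul_one] at h2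
  rw [← Finset.sum_mul, sum_moebius_mul_rpow UniqueFactorizationMonoid.squarefree_radical,
    primeFactors_radical] at h2
  rw [eulerFactor, h2]
  have hs := Real.summable_nat_rpow.2 (show -α < -1 by linarith)
  refine Summable.tsum_le_tsum (fun m => ?_) ?_ ?_
  · split_ifs with h
    · exact mul_le_of_le_one_right (by positivity) (solutionCount_le_one a h)
    · exact le_rfl
  · refine (summable_rpow_mul_of_bounded hα (solutionCount_nonneg N a)
      (solutionCount_le N a)).of_nonneg_of_le (fun m => ?_) fun m => ?_
    all_goals
      have := solutionCount_nonneg N a m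
      split_ifs
    exacts [by positivity, le_rfl, le_rfl, by positivity]
  · refine hs.of_nonneg_of_le (fun m => ?_) fun m => ?_
    all_goals split_ifs
    exacts [by positivity, le_rfl, le_rfl, by positivity]

/-- There are weights on `{1, …, N - 1}` for which `h z` is, on average over `z` and over `h` with
density `h ^ (-α)`, at most as concentrated as the uniform distribution on `N - 1` residues. -/
theorem exists_equidistributing_weights {N : ℕ} (hN : 0 < N) {α : ℝ} (hα : 1 < α) :
    ∃ ρ : ℕ → ℝ≥0∞, (N - 1 : ℕ) ≤ ∑ z ∈ Finset.Icc 1 (N - 1), ρ z ∧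
      (∑ z ∈ Finset.Icc 1 (N - 1), ρ z ≠ ∞) ∧
      ∀ a : ZMod N, ∑ z ∈ Finset.Icc 1 (N - 1), ρ z *
        ∑' h : ℕ, ENNReal.ofReal ((h : ℝ) ^ (-α)) * (if ((h * z : ℕ) : ZMod N) = a then 1 else 0) ≤
      ∑' h : ℕ, ENNReal.ofReal ((h : ℝ) ^ (-α)) := by
  have hm := eulerFactor_pos N hα
  have hIcc : Finset.Icc 1 (N - 1) = (Finset.range N).erase 0 := by
    ext z
    simp only [Finset.mem_Icc, Finset.mem_erase, Finset.mem_range]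
    omega
  have hw : ∀ z, 0 ≤ divisorWeight N α z / eulerFactor N α := fun z =>
    div_nonneg (divisorWeight_nonneg N hα z) hm.le
  refine ⟨fun z => ENNReal.ofReal (divisorWeight N α z / eulerFactor N α), ?_, ?_, fun a => ?_⟩
  · rw [← ENNReal.ofReal_sum_of_nonneg fun z _ => hw z, ← ENNReal.ofReal_natCast]
    refine ENNReal.ofReal_le_ofReal ?_
    rw [hIcc, ← Finset.sum_div, le_div_iff₀ hm, Finset.sum_erase_eq_sub (by simpa using hN),
      sum_divisorWeight, Nat.cast_sub hN, Nat.cast_one]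
    have := divisorWeight_zero_le N hα
    linarith
  · exact (ENNReal.sum_lt_top.2 fun z _ => ENNReal.ofReal_lt_top).ne
  · have hsum : ∀ z : ℕ, Summable fun h : ℕ =>
        (h : ℝ) ^ (-α) * (if ((h * z : ℕ) : ZMod N) = a then (1 : ℝ) else 0) := fun z =>
      summable_rpow_mul_of_bounded (C := 1) hα (fun m => by split_ifs <;> norm_num)
        (fun m => by split_ifs <;> norm_num)
    have hpos : ∀ z h : ℕ, 0 ≤ (h : ℝ) ^ (-α) *
        (if ((h * z : ℕ) : ZMod N) = a then (1 : ℝ) else 0) := fun z h => by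
      split_ifs <;> positivity
    have h1 : ∀ z : ℕ, ∑' h : ℕ, ENNReal.ofReal ((h : ℝ) ^ (-α)) *
        (if ((h * z : ℕ) : ZMod N) = a then 1 else 0) = ENNReal.ofReal
        (∑' h : ℕ, (h : ℝ) ^ (-α) * (if ((h * z : ℕ) : ZMod N) = a then (1 : ℝ) else 0)) := by
      intro z
      rw [ENNReal.ofReal_tsum_of_nonneg (hpos z) (hsum z)]
      exact tsum_congr fun h => by split_ifs <;> simp
    simp only [h1, ← ENNReal.ofReal_mul (hw _)]
    rw [← ENNReal.ofReal_sum_of_nonneg fun z _ => mul_nonneg (hw z) (tsum_nonneg (hpos z)),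
      ← ENNReal.ofReal_tsum_of_nonneg (fun h => by positivity)
        (Real.summable_nat_rpow.2 (show -α < -1 by linarith))]
    refine ENNReal.ofReal_le_ofReal ?_
    have h2 := sum_divisorWeight_mul_tsum_le hN hα a
    rw [← div_le_iff₀' hm, Finset.sum_div] at h2
    refine le_trans ?_ h2
    rw [hIcc]
    simp only [div_mul_eq_mul_div]
    refine Finset.sum_le_sum_of_subset_of_nonneg (Finset.erase_subset _ _) fun z _ _ => ?_
    exact div_nonneg (mul_nonneg (divisorWeight_nonneg N hα z) (tsum_nonneg (hpos z))) hm.le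

/-! ### The worst-case error in terms of the kernel -/

section Representer

variable {s : ℕ} (γ : Fin s → ℝ≥0)

/-- The kernel function at `x`, the representer of evaluation at `x`. -/
noncomputable def kerVec (x : Fin s → I) : SobolevSpace γ :=
  RKHS.kerFun (SobolevSpace γ) x (1 : ℝ)

theorem kerVec_inner (x : Fin s → I) (f : SobolevSpace γ) : inner ℝ (kerVec γ x) f = f x := by
  rw [kerVec, RKHS.kerFun_inner]
  simp

theorem kerVec_inner_kerVec (x y : Fin s → I) :
    inner ℝ (kerVec γ x) (kerVec γ y) = sobKernel γ x y := by
  rw [kerVec_inner, kerVec, RKHS.kerFun_apply, RKHS.OfKernel.kernel_ofKernel]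
  simp [toOperatorKernel]

theorem continuous_sobKernel : Continuous fun p : (Fin s → I) × (Fin s → I) =>
    sobKernel γ p.1 p.2 := by
  simp only [sobKernel, sobKernelOne, Matrix.of_apply, bernoulliFun_one, bernoulliFun_two]
  fun_prop

/-- The squared distance of two kernel functions is a combination of kernel values. Continuity makes
the Bochner integral defining `meanVec` meaningful. -/
theorem continuous_kerVec : Continuous (kerVec γ) := by
  rw [continuous_iff_continuousAt]
  intro x
  rw [ContinuousAt, tendsto_iff_norm_sub_tendsto_zero]
  have h1 : ∀ y, ‖kerVec γ y - kerVec γ x‖ =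
      √(sobKernel γ y y - 2 * sobKernel γ y x + sobKernel γ x x) := by
    intro y
    rw [← kerVec_inner_kerVec, ← kerVec_inner_kerVec, ← kerVec_inner_kerVec,
      real_inner_self_eq_norm_sq, real_inner_self_eq_norm_sq, ← norm_sub_sq_real,
      Real.sqrt_sq (norm_nonneg _)]
  simp only [h1]
  have hK := continuous_sobKernel γ
  have h2 : Continuous fun y => √(sobKernel γ y y - 2 * sobKernel γ y x + sobKernel γ x x) := by
    have ha : Continuous fun y => sobKernel γ y y := hK.comp (continuous_id.prodMk continuous_id)
    have hb : Continuous fun y => sobKernel γ y x := hK.comp (continuous_id.prodMk continuous_const)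
    exact ((ha.sub (hb.const_mul 2)).add continuous_const).sqrt
  have h3 := h2.tendsto x
  rwa [show sobKernel γ x x - 2 * sobKernel γ x x + sobKernel γ x x = 0 by ring,
    Real.sqrt_zero] at h3

theorem integrable_kerVec : Integrable (kerVec γ) :=
  (continuous_kerVec γ).integrable_of_hasCompactSupport (HasCompactSupport.of_compactSpace _)

theorem integral_quadratic (a b u v w : ℝ) :
    ∫ y in a..b, (u + v * y + w * y ^ 2) =
      u * (b - a) + v * ((b ^ 2 - a ^ 2) / 2) + w * ((b ^ 3 - a ^ 3) / 3) := by
  rw [intervalIntegral.integral_add (Continuous.intervalIntegrable (by fun_prop) _ _)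
      (Continuous.intervalIntegrable (by fun_prop) _ _),
    intervalIntegral.integral_add (Continuous.intervalIntegrable (by fun_prop) _ _)
      (Continuous.intervalIntegrable (by fun_prop) _ _),
    intervalIntegral.integral_const_mul, intervalIntegral.integral_const_mul,
    intervalIntegral.integral_const, integral_id, integral_pow]
  norm_num
  ring

theorem integral_sobKernelOne (c : ℝ≥0) (x : I) : ∫ y : I, sobKernelOne c y x = 1 := by
  obtain ⟨x, hx0, hx1⟩ := x
  simp only [sobKernelOne, Matrix.of_apply, bernoulliFun_one, bernoulliFun_two]
  rw [integral_subtype measurableSet_Icc fun y : ℝ => 1 + c * ((y - 1 / 2) * (x - 1 / 2)) +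
    c * ((|y - x| ^ 2 - |y - x| + 6⁻¹) / 2), integral_Icc_eq_integral_Ioc,
    ← intervalIntegral.integral_of_le zero_le_one,
    ← intervalIntegral.integral_add_adjacent_intervals (b := x)
      (Continuous.intervalIntegrable (by fun_prop) _ _)
      (Continuous.intervalIntegrable (by fun_prop) _ _)]
  have h1 : ∀ y ∈ Set.uIcc 0 x, 1 + (c : ℝ) * ((y - 1 / 2) * (x - 1 / 2)) +
      c * ((|y - x| ^ 2 - |y - x| + 6⁻¹) / 2) =
      (1 + c * (-(x - 1 / 2) / 2 + (x ^ 2 - x + 6⁻¹) / 2)) +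
        (c * ((x - 1 / 2) + (-2 * x + 1) / 2)) * y + c / 2 * y ^ 2 := by
    intro y hy
    rw [Set.uIcc_of_le hx0] at hy
    rw [sq_abs, abs_of_nonpos (by linarith [hy.2])]
    ring
  have h2 : ∀ y ∈ Set.uIcc x 1, 1 + (c : ℝ) * ((y - 1 / 2) * (x - 1 / 2)) +
      c * ((|y - x| ^ 2 - |y - x| + 6⁻¹) / 2) =
      (1 + c * (-(x - 1 / 2) / 2 + (x ^ 2 + x + 6⁻¹) / 2)) +
        (c * ((x - 1 / 2) + (-2 * x - 1) / 2)) * y + c / 2 * y ^ 2 := by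
    intro y hy
    rw [Set.uIcc_of_le hx1] at hy
    rw [sq_abs, abs_of_nonneg (by linarith [hy.1])]
    ring
  rw [intervalIntegral.integral_congr h1, intervalIntegral.integral_congr h2, integral_quadratic,
    integral_quadratic]
  ring

theorem integral_sobKernel (x : Fin s → I) : ∫ y : Fin s → I, sobKernel γ y x = 1 := by
  simp only [sobKernel, Matrix.of_apply]
  rw [integral_fintype_prod_volume_eq_prod fun j (t : I) => sobKernelOne (γ j) t (x j)]
  simp [integral_sobKernelOne]

/-- The representer of integration. -/
noncomputable def meanVec : SobolevSpace γ := ∫ x : Fin s → I, kerVec γ x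

theorem meanVec_inner (f : SobolevSpace γ) : inner ℝ (meanVec γ) f = ∫ x : Fin s → I, f x := by
  rw [real_inner_comm, meanVec, ← integral_inner (integrable_kerVec γ)]
  exact integral_congr_ae (Filter.Eventually.of_forall fun x => by
    simp only [real_inner_comm _ f, kerVec_inner])

theorem meanVec_inner_kerVec (x : Fin s → I) : inner ℝ (meanVec γ) (kerVec γ x) = 1 := by
  rw [meanVec_inner, ← integral_sobKernel γ x]
  exact integral_congr_ae (Filter.Eventually.of_forall fun y => by
    simp only [← kerVec_inner, kerVec_inner_kerVec])

theorem meanVec_inner_self : inner ℝ (meanVec γ) (meanVec γ) = 1 := by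
  rw [meanVec_inner]
  simp only [← kerVec_inner, real_inner_comm (meanVec γ), meanVec_inner_kerVec]
  simp

/-- The representer of the integration error of an equal-weight rule. -/
noncomputable def errorVec {N : ℕ} (P : Fin N → Fin s → I) : SobolevSpace γ :=
  meanVec γ - (1 / (N : ℝ)) • ∑ n, kerVec γ (P n)

theorem errorVec_inner {N : ℕ} (P : Fin N → Fin s → I) (f : SobolevSpace γ) :
    inner ℝ (errorVec γ P) f = (∫ x : Fin s → I, f x) - (1 / (N : ℝ)) * ∑ n, f (P n) := by
  simp only [errorVec, inner_sub_left, real_inner_smul_left, sum_inner, meanVec_inner,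
    kerVec_inner]

theorem norm_errorVec_sq {N : ℕ} (hN : 0 < N) (P : Fin N → Fin s → I) :
    ‖errorVec γ P‖ ^ 2 = (1 / (N : ℝ) ^ 2) * (∑ n, ∑ m, sobKernel γ (P n) (P m)) - 1 := by
  have hN' : (N : ℝ) ≠ 0 := mod_cast hN.ne'
  rw [errorVec, norm_sub_sq_real, ← real_inner_self_eq_norm_sq, ← real_inner_self_eq_norm_sq,
    meanVec_inner_self]
  simp only [real_inner_smul_left, real_inner_smul_right, inner_sum, sum_inner,
    meanVec_inner_kerVec, kerVec_inner_kerVec]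
  rw [Finset.sum_comm, ← Finset.mul_sum, Finset.sum_const, Finset.card_univ, Fintype.card_fin,
    nsmul_eq_mul]
  field_simp
  ring

/-- Cauchy–Schwarz, with equality at the normalised representer. -/
theorem worstCaseError_eq_norm {N : ℕ} (P : Fin N → Fin s → I) :
    worstCaseError (SobolevSpace γ) P = ENNReal.ofReal ‖errorVec γ P‖ := by
  simp only [worstCaseError, ← errorVec_inner]
  set ξ := errorVec γ P
  refine le_antisymm (iSup₂_le fun f hf => ENNReal.ofReal_le_ofReal ?_) ?_
  · refine (abs_real_inner_le_norm ξ f).trans ?_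
    exact mul_le_of_le_one_right (norm_nonneg _) hf
  · by_cases hξ : ‖ξ‖ = 0
    · simp [hξ]
    · refine le_trans (ENNReal.ofReal_le_ofReal ?_) 
        (le_iSup₂ (f := fun (f : SobolevSpace γ) (_ : ‖f‖ ≤ 1) =>
          ENNReal.ofReal |inner ℝ ξ f|) (‖ξ‖⁻¹ • ξ) ?_)
      · rw [real_inner_smul_right, real_inner_self_eq_norm_sq]
        refine le_trans (le_of_eq ?_) (le_abs_self _)
        field_simp
      · rw [norm_smul, norm_inv, norm_norm, inv_mul_cancel₀ hξ]

end Representer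

/-! ### Cosine vectors and the quadratic form of the kernel at the nodes -/

/-- The vector `n ↦ cos (2 π b n / N)`. -/
noncomputable def cosVec {N : ℕ} [NeZero N] (b : ZMod N) (n : Fin N) : ℝ :=
  (ZMod.stdAddChar (b * ((n : ℕ) : ZMod N))).re

section CosVec

variable {N : ℕ} [NeZero N]

theorem cosVec_natCast (b : ℕ) (n : Fin N) :
    cosVec (b : ZMod N) n = Real.cos (2 * Real.pi * (b * (n : ℕ) / N)) := by
  have h : ((b : ZMod N) * ((n : ℕ) : ZMod N)) = (((b * (n : ℕ) : ℕ) : ℤ) : ZMod N) := by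
    push_cast
    rfl
  rw [cosVec, h, ZMod.stdAddChar_coe, ← Complex.exp_ofReal_mul_I_re]
  congr 2
  push_cast
  ring

theorem cosVec_mul (a b : ZMod N) (n : Fin N) :
    cosVec a n * cosVec b n = (cosVec (a + b) n + cosVec (a - b) n) / 2 := by
  have hneg : ∀ x : ZMod N, ZMod.stdAddChar (-x) = (starRingEnd ℂ) (ZMod.stdAddChar x) := fun x =>
    AddChar.map_neg_eq_conj _ x
  simp only [cosVec, sub_eq_add_neg, add_mul, neg_mul, AddChar.map_add_eq_mul, hneg,
    Complex.mul_re, Complex.conj_re, Complex.conj_im]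
  ring

theorem sum_cosVec (b : ZMod N) : ∑ n, cosVec b n = if b = 0 then (N : ℝ) else 0 := by
  have hbij : Function.Bijective fun n : Fin N => ((n : ℕ) : ZMod N) := by
    refine (Fintype.bijective_iff_injective_and_card _).2 ⟨fun x y h => ?_, by simp [ZMod.card]⟩
    have h' := (ZMod.natCast_eq_natCast_iff _ _ _).1 h
    exact Fin.ext (h'.eq_of_lt_of_lt x.2 y.2)
  have h1 : ∑ n : Fin N, ZMod.stdAddChar (b * ((n : ℕ) : ZMod N)) =
      if b = 0 then (N : ℂ) else 0 := by
    rw [hbij.sum_comp fun x : ZMod N => (ZMod.stdAddChar (b * x) : ℂ)]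
    have h2 := AddChar.sum_mulShift b (ZMod.isPrimitive_stdAddChar N)
    simp only [mul_comm _ b, ZMod.card] at h2
    rw [h2]
    split_ifs <;> simp
  simp only [cosVec, ← Complex.re_sum, h1]
  split_ifs <;> simp

/-- The tent is 2x or 2 - 2x, and the cosine is even and periodic. The half-period cosines of the
kernel thus become full-period ones, on which the lattice structure acts. -/
theorem cos_mul_tent (k : ℕ) (x : I) :
    Real.cos (Real.pi * k * tent x) = Real.cos (2 * Real.pi * k * x) := by
  simp only [tent]
  rcases abs_cases (2 * (x : ℝ) - 1) with ⟨h, _⟩ | ⟨h, _⟩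
  · rw [h, ← Real.cos_nat_mul_two_pi_sub _ k]
    congr 1
    ring
  · rw [h]
    congr 1
    ring

theorem cos_tentLatticePoint {s : ℕ} (g : Fin s → ℕ) (n : Fin N) (j : Fin s) (k : ℕ) :
    Real.cos (Real.pi * k * tentLatticePoint N g n j) = cosVec ((k * g j : ℕ) : ZMod N) n := by
  rw [tentLatticePoint, cos_mul_tent, cosVec_natCast]
  simp only [latticePoint, Int.fract]
  rw [← Real.cos_sub_int_mul_two_pi (2 * Real.pi * _)
    (k * ⌊((n : ℕ) : ℝ) * (g j : ℝ) / (N : ℝ)⌋)]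
  congr 1
  push_cast
  ring

end CosVec

/-- The coefficient `2 γ / (π k)²` of the kernel, which is `0` for `k = 0`. -/
noncomputable def kerCoeff (c : ℝ≥0) (k : ℕ) : ℝ := c / Real.pi ^ 2 * (2 / (k : ℝ) ^ 2)

theorem kerCoeff_nonneg (c : ℝ≥0) (k : ℕ) : 0 ≤ kerCoeff c k := by
  unfold kerCoeff
  positivity

/-- The quadratic form of the kernel at the nodes of the tent-transformed lattice rule. -/
noncomputable def kerForm {s : ℕ} (N : ℕ) (γ : Fin s → ℝ≥0) (g : Fin s → ℕ) (u : Fin N → ℝ) : ℝ :=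
  (1 / (N : ℝ) ^ 2) * ∑ n, ∑ m,
    sobKernel γ (tentLatticePoint N g n) (tentLatticePoint N g m) * (u n * u m)

section KerForm

variable {s N : ℕ} (γ : Fin s → ℝ≥0) (g : Fin s → ℕ)

theorem kerForm_eq_norm_sq (u : Fin N → ℝ) :
    kerForm N γ g u = ‖(1 / (N : ℝ)) • ∑ n, u n • kerVec γ (tentLatticePoint N g n)‖ ^ 2 := by
  rw [← real_inner_self_eq_norm_sq]
  simp only [real_inner_smul_left, real_inner_smul_right, inner_sum, sum_inner,
    kerVec_inner_kerVec]
  simp only [kerForm, Finset.mul_sum]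
  rw [Finset.sum_comm]
  exact Finset.sum_congr rfl fun n _ => Finset.sum_congr rfl fun m _ => by ring

theorem kerForm_nonneg (u : Fin N → ℝ) : 0 ≤ kerForm N γ g u := by
  rw [kerForm_eq_norm_sq]
  positivity

/-- Parallelogram law, dropping the non-negative form at the half-difference; a further factor 1/2
is given away. -/
theorem kerForm_midpoint_le (u v : Fin N → ℝ) :
    kerForm N γ g (fun n => (u n + v n) / 2) ≤ kerForm N γ g u + kerForm N γ g v := by
  have h := kerForm_nonneg γ g fun n => (u n - v n) / 2
  have h2 : kerForm N γ g (fun n => (u n + v n) / 2) + kerForm N γ g (fun n => (u n - v n) / 2) =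
      (kerForm N γ g u + kerForm N γ g v) / 2 := by
    simp only [kerForm, ← mul_add, ← Finset.sum_add_distrib, mul_div_assoc, Finset.sum_div]
    congr 1
    exact Finset.sum_congr rfl fun n _ => Finset.sum_congr rfl fun m _ => by ring
  have hu := kerForm_nonneg γ g u
  have hv := kerForm_nonneg γ g v
  linarith

theorem kerForm_cosVec_mul_le [NeZero N] (a b : ZMod N) :
    kerForm N γ g (fun n => cosVec a n * cosVec b n) ≤
      kerForm N γ g (cosVec (a + b)) + kerForm N γ g (cosVec (a - b)) := by
  simp only [cosVec_mul]
  exact kerForm_midpoint_le γ g _ _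

theorem sobError_sq_eq (hN : 0 < N) :
    ‖errorVec γ (tentLatticePoint N g)‖ ^ 2 = kerForm N γ g (fun _ => 1) - 1 := by
  rw [norm_errorVec_sq γ hN, kerForm]
  simp

end KerForm

/-- Adding a dimension adds to the quadratic form a series of twisted quadratic forms. -/
theorem hasSum_kerForm_succ {d N : ℕ} [NeZero N] (γ : Fin (d + 1) → ℝ≥0) (g : Fin (d + 1) → ℕ)
    (u : Fin N → ℝ) :
    HasSum (fun k : ℕ => kerCoeff (γ (Fin.last d)) k *
        kerForm N (Fin.init γ) (Fin.init g)
          fun n => u n * cosVec ((k * g (Fin.last d) : ℕ) : ZMod N) n)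
      (kerForm N γ g u - kerForm N (Fin.init γ) (Fin.init g) u) := by
  have h1 : ∀ n m : Fin N, sobKernel γ (tentLatticePoint N g n) (tentLatticePoint N g m) =
      sobKernel (Fin.init γ) (tentLatticePoint N (Fin.init g) n)
        (tentLatticePoint N (Fin.init g) m) *
      sobKernelOne (γ (Fin.last d)) (tentLatticePoint N g n (Fin.last d))
        (tentLatticePoint N g m (Fin.last d)) := by
    intro n m
    simp only [sobKernel, Matrix.of_apply, Fin.prod_univ_castSucc]
    rfl
  have h2 : ∀ n m : Fin N, HasSum (fun k : ℕ => kerCoeff (γ (Fin.last d)) k *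
      (cosVec ((k * g (Fin.last d) : ℕ) : ZMod N) n *
        cosVec ((k * g (Fin.last d) : ℕ) : ZMod N) m))
      (sobKernelOne (γ (Fin.last d)) (tentLatticePoint N g n (Fin.last d))
        (tentLatticePoint N g m (Fin.last d)) - 1) := by
    intro n m
    have h := hasSum_sobKernelOne (γ (Fin.last d)) (tentLatticePoint N g n (Fin.last d))
      (tentLatticePoint N g m (Fin.last d))
    simpa only [cos_tentLatticePoint, kerCoeff] using h
  have h3 := (hasSum_sum (s := Finset.univ) fun n _ => hasSum_sum (s := Finset.univ) fun m _ =>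
    (h2 n m).mul_left (sobKernel (Fin.init γ) (tentLatticePoint N (Fin.init g) n)
        (tentLatticePoint N (Fin.init g) m) * (u n * u m))).mul_left (1 / (N : ℝ) ^ 2)
  convert! h3 using 1
  · funext k
    rw [kerForm, mul_left_comm, Finset.mul_sum]
    congr 1
    refine Finset.sum_congr rfl fun n _ => ?_
    rw [Finset.mul_sum]
    exact Finset.sum_congr rfl fun m _ => by ring
  · rw [kerForm, kerForm, ← mul_sub, ← Finset.sum_sub_distrib]
    congr 1
    refine Finset.sum_congr rfl fun n _ => ?_
    rw [← Finset.sum_sub_distrib]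
    exact Finset.sum_congr rfl fun m _ => by rw [h1]; ring

/-- Used with c = 0 for the power sums and c = 1 for the squared error. In [0, ∞] the later
exchanges of sums need no summability. -/
theorem ofReal_kerForm_succ_sub {d N : ℕ} [NeZero N] (γ : Fin (d + 1) → ℝ≥0)
    (g : Fin (d + 1) → ℕ) (u : Fin N → ℝ) {c : ℝ}
    (hc : c ≤ kerForm N (Fin.init γ) (Fin.init g) u) :
    ENNReal.ofReal (kerForm N γ g u - c) =
      ENNReal.ofReal (kerForm N (Fin.init γ) (Fin.init g) u - c) +
      ∑' k : ℕ, ENNReal.ofReal (kerCoeff (γ (Fin.last d)) k) *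
        ENNReal.ofReal (kerForm N (Fin.init γ) (Fin.init g)
          fun n => u n * cosVec ((k * g (Fin.last d) : ℕ) : ZMod N) n) := by
  have h := hasSum_kerForm_succ γ g u
  have hnn : ∀ k : ℕ, 0 ≤ kerCoeff (γ (Fin.last d)) k *
      kerForm N (Fin.init γ) (Fin.init g)
        fun n => u n * cosVec ((k * g (Fin.last d) : ℕ) : ZMod N) n := fun k =>
    mul_nonneg (kerCoeff_nonneg _ _) (kerForm_nonneg _ _ _)
  simp only [← ENNReal.ofReal_mul (kerCoeff_nonneg _ _)]
  rw [← ENNReal.ofReal_tsum_of_nonneg hnn h.summable, h.tsum_eq,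
    ← ENNReal.ofReal_add (sub_nonneg.2 hc) (h.nonneg hnn)]
  congr 1
  ring

theorem tsum_rpow_le {f : ℕ → ℝ≥0∞} {p : ℝ} (hp0 : 0 < p) (hp1 : p ≤ 1) :
    (∑' k, f k) ^ p ≤ ∑' k, f k ^ p := by
  have h1 : Filter.Tendsto (fun t : Finset ℕ => (∑ k ∈ t, f k) ^ p) Filter.atTop
      (nhds ((∑' k, f k) ^ p)) :=
    (ENNReal.continuous_rpow_const.tendsto _).comp ENNReal.summable.hasSum
  refine le_of_tendsto' h1 fun t => le_trans ?_ (ENNReal.sum_le_tsum t)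
  induction t using Finset.induction_on with
  | empty =>
    simp [hp0]
  | insert k t hk ih =>
    rw [Finset.sum_insert hk, Finset.sum_insert hk]
    exact (ENNReal.rpow_add_le_add_rpow _ _ hp0.le hp1).trans (by gcongr)

/-- The factor 2/π² ≤ 1 is discarded. At k = 0 both sides vanish, by the conventions for division by
zero and for powers of zero. -/
theorem ofReal_kerCoeff_rpow_le (c : ℝ≥0) (k : ℕ) {p : ℝ} (hp : 0 < p) :
    ENNReal.ofReal (kerCoeff c k) ^ p ≤
      (c : ℝ≥0∞) ^ p * ENNReal.ofReal ((k : ℝ) ^ (-(2 * p))) := by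
  have hpi : 2 / Real.pi ^ 2 ≤ 1 := by
    rw [div_le_one (by positivity)]
    nlinarith [Real.pi_gt_three]
  have h1 : kerCoeff c k ≤ c * ((k : ℝ) ^ 2)⁻¹ := by
    have h : kerCoeff c k = 2 / Real.pi ^ 2 * (c * ((k : ℝ) ^ 2)⁻¹) := by
      unfold kerCoeff
      ring
    rw [h]
    exact mul_le_of_le_one_left (by positivity) hpi
  have h2 : (((k : ℝ) ^ 2)⁻¹) ^ p = (k : ℝ) ^ (-(2 * p)) := by
    rw [Real.inv_rpow (by positivity), Real.rpow_neg (by positivity), Real.rpow_mul (by positivity),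
      Real.rpow_two]
  calc ENNReal.ofReal (kerCoeff c k) ^ p
      ≤ ENNReal.ofReal (c * ((k : ℝ) ^ 2)⁻¹) ^ p := by gcongr
    _ = (c : ℝ≥0∞) ^ p * ENNReal.ofReal ((k : ℝ) ^ (-(2 * p))) := by
      rw [ENNReal.ofReal_mul c.coe_nonneg, ENNReal.mul_rpow_of_nonneg _ _ hp.le,
        ENNReal.ofReal_coe_nnreal, ENNReal.ofReal_rpow_of_nonneg (by positivity) hp.le, h2]

/-! ### One step of the component-by-component algorithm -/

/-- The `p`-th power sum of the quadratic form over all cosine vectors. -/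
noncomputable def cosPowerSum {s : ℕ} (N : ℕ) [NeZero N] (γ : Fin s → ℝ≥0) (g : Fin s → ℕ)
    (p : ℝ) : ℝ≥0∞ :=
  ∑ b : ZMod N, ENNReal.ofReal (kerForm N γ g (cosVec b)) ^ p

/-- The series `∑ h ^ (-2p)` in `[0, ∞]`. -/
noncomputable def zetaSum (p : ℝ) : ℝ≥0∞ := ∑' h : ℕ, ENNReal.ofReal ((h : ℝ) ^ (-(2 * p)))

theorem kerForm_fin_zero {N : ℕ} (γ : Fin 0 → ℝ≥0) (g : Fin 0 → ℕ) (u : Fin N → ℝ) :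
    kerForm N γ g u = ((∑ n, u n) / N) ^ 2 := by
  simp only [kerForm, sobKernel, Matrix.of_apply, Finset.univ_eq_empty, Finset.prod_empty, one_mul,
    ← Finset.sum_mul_sum]
  ring

section Step

variable {N : ℕ} [NeZero N] {p : ℝ}

theorem cosPowerSum_fin_zero (hp : 0 < p) (γ : Fin 0 → ℝ≥0) (g : Fin 0 → ℕ) :
    cosPowerSum N γ g p = 1 := by
  have hN : (N : ℝ) ≠ 0 := NeZero.ne _
  rw [cosPowerSum, Finset.sum_eq_single 0]
  · simp [kerForm_fin_zero, sum_cosVec, hN]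
  · intro b _ hb
    simp [kerForm_fin_zero, sum_cosVec, hb, hp]
  · simp

theorem tsum_kerCoeff_mul_rpow_le (hp0 : 0 < p) (hp1 : p ≤ 1) (c : ℝ≥0) (f : ℕ → ℝ≥0∞) :
    (∑' k, ENNReal.ofReal (kerCoeff c k) * f k) ^ p ≤
      (c : ℝ≥0∞) ^ p * ∑' k : ℕ, ENNReal.ofReal ((k : ℝ) ^ (-(2 * p))) * f k ^ p := by
  refine (tsum_rpow_le hp0 hp1).trans ?_
  rw [← ENNReal.tsum_mul_left]
  refine ENNReal.tsum_le_tsum fun k => ?_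
  rw [ENNReal.mul_rpow_of_nonneg _ _ hp0.le, ← mul_assoc]
  gcongr
  exact ofReal_kerCoeff_rpow_le c k hp0

/-- Multiplying by a cosine vector shifts the frequency b by ± kg, and a sum over all residues is
invariant under shifts. The two signs produce the factor 2. -/
theorem cosPowerSum_succ_le {d : ℕ} (hp0 : 0 < p) (hp1 : p ≤ 1) (γ : Fin (d + 1) → ℝ≥0)
    (g : Fin (d + 1) → ℕ) :
    cosPowerSum N γ g p ≤ cosPowerSum N (Fin.init γ) (Fin.init g) p *
      (1 + 2 * zetaSum p * (γ (Fin.last d) : ℝ≥0∞) ^ p) := by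
  set c := γ (Fin.last d)
  set S := cosPowerSum N (Fin.init γ) (Fin.init g) p
  let w : ℕ → ℝ≥0∞ := fun k => ENNReal.ofReal ((k : ℝ) ^ (-(2 * p)))
  let R : ZMod N → ℝ≥0∞ := fun b =>
    ENNReal.ofReal (kerForm N (Fin.init γ) (Fin.init g) (cosVec b)) ^ p
  let y : ℕ → ZMod N := fun k => ((k * g (Fin.last d) : ℕ) : ZMod N)
  have h1 : ∀ b : ZMod N, ENNReal.ofReal (kerForm N γ g (cosVec b)) ^ p ≤
      R b + (c : ℝ≥0∞) ^ p * ∑' k, w k * (R (b + y k) + R (b - y k)) := by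
    intro b
    have h := ofReal_kerForm_succ_sub γ g (cosVec b) (kerForm_nonneg _ _ _)
    simp only [sub_zero] at h
    rw [h]
    refine (ENNReal.rpow_add_le_add_rpow _ _ hp0.le hp1).trans ?_
    refine add_le_add le_rfl ((tsum_kerCoeff_mul_rpow_le hp0 hp1 _ _).trans ?_)
    gcongr with k
    refine le_trans ?_ (ENNReal.rpow_add_le_add_rpow _ _ hp0.le hp1)
    gcongr
    rw [← ENNReal.ofReal_add (kerForm_nonneg _ _ _) (kerForm_nonneg _ _ _)]
    exact ENNReal.ofReal_le_ofReal (kerForm_cosVec_mul_le _ _ _ _)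
  have h2 : ∀ x : ZMod N, ∑ b, (R (b + x) + R (b - x)) = 2 * S := by
    intro x
    have ha : ∑ b, R (b + x) = S := Equiv.sum_comp (Equiv.addRight x) R
    have hb : ∑ b, R (b - x) = S := Equiv.sum_comp (Equiv.subRight x) R
    rw [Finset.sum_add_distrib, ha, hb, two_mul]
  calc cosPowerSum N γ g p
      ≤ ∑ b, (R b + (c : ℝ≥0∞) ^ p * ∑' k, w k * (R (b + y k) + R (b - y k))) :=
        Finset.sum_le_sum fun b _ => h1 b
    _ = S + (c : ℝ≥0∞) ^ p * ∑' k, w k * (2 * S) := by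
        rw [Finset.sum_add_distrib, ← Finset.mul_sum,
          ← Summable.tsum_finsetSum fun _ _ => ENNReal.summable]
        simp only [← Finset.mul_sum, h2]
        rfl
    _ = S * (1 + 2 * zetaSum p * (c : ℝ≥0∞) ^ p) := by
        rw [ENNReal.tsum_mul_right, zetaSum]
        ring

theorem cosPowerSum_le_prod (hp0 : 0 < p) (hp1 : p ≤ 1) {d : ℕ} (γ : Fin d → ℝ≥0)
    (g : Fin d → ℕ) :
    cosPowerSum N γ g p ≤ ∏ j, (1 + 2 * zetaSum p * (γ j : ℝ≥0∞) ^ p) := by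
  induction d with
  | zero => simp [cosPowerSum_fin_zero hp0]
  | succ d ih =>
    rw [Fin.prod_univ_castSucc]
    exact (cosPowerSum_succ_le hp0 hp1 γ g).trans (by gcongr; exact ih (Fin.init γ) (Fin.init g))

theorem one_le_kerForm {d : ℕ} (γ : Fin d → ℝ≥0) (g : Fin d → ℕ) :
    1 ≤ kerForm N γ g fun _ => 1 := by
  have h := sobError_sq_eq γ g (NeZero.pos N)
  nlinarith [sq_nonneg ‖errorVec γ (tentLatticePoint N g)‖]

/-- Writing R as a combination of indicators of residues reduces the bound to the hypothesis at each
residue. -/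
theorem sum_weights_mul_tsum_le {ρ w : ℕ → ℝ≥0∞} {t : Finset ℕ} {A : ℝ≥0∞} (R : ZMod N → ℝ≥0∞)
    (h : ∀ a : ZMod N, ∑ z ∈ t, ρ z *
      ∑' k, w k * (if ((k * z : ℕ) : ZMod N) = a then 1 else 0) ≤ A) :
    ∑ z ∈ t, ρ z * ∑' k, w k * R ((k * z : ℕ) : ZMod N) ≤ A * ∑ a, R a := by
  have h1 : ∀ x : ZMod N, R x = ∑ a, (if x = a then 1 else 0) * R a := by
    intro x
    simp
  calc ∑ z ∈ t, ρ z * ∑' k, w k * R ((k * z : ℕ) : ZMod N)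
      = ∑ z ∈ t, ρ z * ∑' k, ∑ a, w k * (if ((k * z : ℕ) : ZMod N) = a then 1 else 0) * R a := by
        refine Finset.sum_congr rfl fun z _ => ?_
        congr 1
        refine tsum_congr fun k => ?_
        rw [h1, Finset.mul_sum]
        simp only [mul_assoc]
    _ = ∑ a, (∑ z ∈ t, ρ z *
          ∑' k, w k * (if ((k * z : ℕ) : ZMod N) = a then 1 else 0)) * R a := by
        simp only [Finset.sum_mul]
        rw [Finset.sum_comm]
        refine Finset.sum_congr rfl fun z _ => ?_
        rw [Summable.tsum_finsetSum fun _ _ => ENNReal.summable, Finset.mul_sum]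
        refine Finset.sum_congr rfl fun a _ => ?_
        rw [ENNReal.tsum_mul_right, mul_assoc]
    _ ≤ A * ∑ a, R a := by
        rw [Finset.mul_sum]
        gcongr with a
        exact h a

/-- The total mass W of the weights may exceed M = N - 1, so only the truncated excess e - E is
compared, and there a smaller mass is harmless. -/
theorem mul_le_of_weighted_mean_le {e E W X M : ℝ≥0∞} (hW : W ≠ ∞) (hMW : M ≤ W)
    (h : e * W ≤ E * W + X) : e * M ≤ E * M + X := by
  have h1 : (e - E) * W ≤ X := by
    rw [ENNReal.sub_mul fun _ _ => hW]
    exact tsub_le_iff_left.2 h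
  calc e * M ≤ (E + (e - E)) * M := by gcongr; exact le_add_tsub
    _ = E * M + (e - E) * M := add_mul _ _ _
    _ ≤ E * M + X := by gcongr; exact le_trans (by gcongr) h1

theorem error_step_le {d : ℕ} (hp : 1 < 2 * p) (hp1 : p ≤ 1) (γ : Fin (d + 1) → ℝ≥0)
    (g : Fin (d + 1) → ℕ)
    (hmin : ∀ z ∈ Finset.Icc 1 (N - 1), kerForm N γ g (fun _ => 1) ≤
      kerForm N γ (Function.update g (Fin.last d) z) fun _ => 1) :
    ENNReal.ofReal (kerForm N γ g (fun _ => 1) - 1) ^ p * (N - 1 : ℕ) ≤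
      ENNReal.ofReal (kerForm N (Fin.init γ) (Fin.init g) (fun _ => 1) - 1) ^ p * (N - 1 : ℕ) +
        zetaSum p * (γ (Fin.last d) : ℝ≥0∞) ^ p *
          cosPowerSum N (Fin.init γ) (Fin.init g) p := by
  have hp0 : 0 < p := by linarith
  obtain ⟨ρ, hρ1, hρ2, hρ3⟩ := exists_equidistributing_weights (NeZero.pos N) hp
  set c := γ (Fin.last d)
  let R : ZMod N → ℝ≥0∞ := fun b =>
    ENNReal.ofReal (kerForm N (Fin.init γ) (Fin.init g) (cosVec b)) ^ p
  set E := ENNReal.ofReal (kerForm N (Fin.init γ) (Fin.init g) (fun _ => 1) - 1) ^ p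
  have hz : ∀ z ∈ Finset.Icc 1 (N - 1), ENNReal.ofReal (kerForm N γ g (fun _ => 1) - 1) ^ p ≤
      E + (c : ℝ≥0∞) ^ p *
        ∑' k : ℕ, ENNReal.ofReal ((k : ℝ) ^ (-(2 * p))) * R ((k * z : ℕ) : ZMod N) := by
    intro z hz
    have h := ofReal_kerForm_succ_sub γ (Function.update g (Fin.last d) z) (fun _ : Fin N => 1)
      (one_le_kerForm _ _)
    simp only [Fin.init_update_last, Function.update_self, one_mul] at h
    calc ENNReal.ofReal (kerForm N γ g (fun _ => 1) - 1) ^ p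
        ≤ ENNReal.ofReal
            (kerForm N γ (Function.update g (Fin.last d) z) (fun _ => 1) - 1) ^ p := by
          gcongr
          exact hmin z hz
      _ ≤ _ := by
          rw [h]
          refine (ENNReal.rpow_add_le_add_rpow _ _ hp0.le hp1).trans ?_
          exact add_le_add le_rfl (tsum_kerCoeff_mul_rpow_le hp0 hp1 _ _)
  refine mul_le_of_weighted_mean_le hρ2 hρ1 ?_
  rw [Finset.mul_sum, Finset.mul_sum]
  calc ∑ z ∈ Finset.Icc 1 (N - 1), ENNReal.ofReal (kerForm N γ g (fun _ => 1) - 1) ^ p * ρ z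
      ≤ ∑ z ∈ Finset.Icc 1 (N - 1), (E + (c : ℝ≥0∞) ^ p *
          ∑' k : ℕ, ENNReal.ofReal ((k : ℝ) ^ (-(2 * p))) * R ((k * z : ℕ) : ZMod N)) * ρ z := by
        gcongr with z hz'
        exact hz z hz'
    _ = ∑ z ∈ Finset.Icc 1 (N - 1), E * ρ z + (c : ℝ≥0∞) ^ p *
          ∑ z ∈ Finset.Icc 1 (N - 1), ρ z *
            ∑' k : ℕ, ENNReal.ofReal ((k : ℝ) ^ (-(2 * p))) * R ((k * z : ℕ) : ZMod N) := by
        rw [Finset.mul_sum, ← Finset.sum_add_distrib]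
        exact Finset.sum_congr rfl fun z _ => by ring
    _ ≤ _ := by
        rw [mul_comm (zetaSum p), mul_assoc ((c : ℝ≥0∞) ^ p)]
        gcongr
        exact sum_weights_mul_tsum_le R hρ3

end Step

/-! ### The error bound -/

theorem sobError_eq {s N : ℕ} (γ : Fin s → ℝ≥0) (g : Fin s → ℕ) :
    sobError N γ g = ENNReal.ofReal ‖errorVec γ (tentLatticePoint N g)‖ :=
  worstCaseError_eq_norm γ _

theorem kerForm_le_of_sobError_le {s N : ℕ} (hN : 0 < N) {γ : Fin s → ℝ≥0} {g g' : Fin s → ℕ}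
    (h : sobError N γ g ≤ sobError N γ g') :
    kerForm N γ g (fun _ => 1) ≤ kerForm N γ g' fun _ => 1 := by
  rw [sobError_eq, sobError_eq, ENNReal.ofReal_le_ofReal_iff (norm_nonneg _)] at h
  have h2 := pow_le_pow_left₀ (norm_nonneg _) h 2
  rw [sobError_sq_eq γ g hN, sobError_sq_eq γ g' hN] at h2
  linarith

/-- The added 1 is the term of the empty set in the product, so the induction closes on the full
product instead of the product minus 1. -/
theorem IsCBCVector.error_le {s N : ℕ} [NeZero N] {γ : Fin s → ℝ≥0} {g : Fin s → ℕ}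
    (h : IsCBCVector N γ g) {p : ℝ} (hp : 1 < 2 * p) (hp1 : p ≤ 1) {d : ℕ} (hd : d ≤ s) :
    ENNReal.ofReal (kerForm N (initial hd γ) (initial hd g) (fun _ => 1) - 1) ^ p * (N - 1 : ℕ) + 1
      ≤ ∏ j, (1 + 2 * zetaSum p * ((initial hd γ j : ℝ≥0) : ℝ≥0∞) ^ p) := by
  have hp0 : 0 < p := by linarith
  induction d with
  | zero =>
    have hN : (N : ℝ) ≠ 0 := NeZero.ne _
    simp [kerForm_fin_zero, hN, hp0]
  | succ d ih =>
    have h1 := error_step_le hp hp1 (initial hd γ) (initial hd g) fun z hz =>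
      kerForm_le_of_sobError_le (NeZero.pos N) (h.2 d hd z hz)
    have h2 := ih (Nat.le_of_succ_le hd)
    have h3 := cosPowerSum_le_prod (N := N) (by linarith) hp1 (Fin.init (initial hd γ))
      (Fin.init (initial hd g))
    rw [Fin.prod_univ_castSucc]
    set B := ∏ j : Fin d, (1 + 2 * zetaSum p * ((initial hd γ j.castSucc : ℝ≥0) : ℝ≥0∞) ^ p)
    set x := zetaSum p * ((initial hd γ (Fin.last d) : ℝ≥0) : ℝ≥0∞) ^ p
    calc _ ≤ _ + x * cosPowerSum N (Fin.init (initial hd γ)) (Fin.init (initial hd g)) p + 1 := by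
          gcongr
      _ ≤ B + x * B := by
          rw [add_right_comm]
          gcongr
          · exact h2
          · exact h3
      -- The error alone would need only the factor 1 + x; the 2 is spent to match the growth 1 + 2x
      -- of the power sums.
      _ ≤ B + 2 * (x * B) := by
          rw [two_mul]
          exact add_le_add le_rfl le_self_add
      _ = _ := by ring

theorem initial_self {α : Type*} {s : ℕ} (v : Fin s → α) : initial le_rfl v = v := rfl

theorem tsum_rpow_eq_riemannZeta_re {α : ℝ} (hα : 1 < α) :
    ∑' h : ℕ, (h : ℝ) ^ (-α) = (riemannZeta (α : ℂ)).re := by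
  rw [zeta_eq_tsum_one_div_nat_cpow (by simpa using hα), ← Complex.ofReal_re (∑' h : ℕ, _)]
  congr 1
  push_cast
  refine tsum_congr fun h => ?_
  rw [Complex.ofReal_cpow (by positivity)]
  push_cast
  rw [Complex.cpow_neg, one_div]

theorem cbcConst_eq {s : ℕ} (γ : Fin s → ℝ≥0) (τ : ℝ) :
    cbcConst γ τ = (-1 + ∏ j, (1 + 2 * (riemannZeta ((2 / τ : ℝ) : ℂ)).re *
      (γ j : ℝ) ^ (1 / τ))) ^ (τ / 2) := by
  rw [cbcConst]
  congr 1
  rw [Finset.prod_one_add, Finset.powerset_univ, ← Finset.add_sum_erase _ _ (Finset.mem_univ ∅)]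
  simp only [Finset.prod_empty, neg_add_cancel_left]
  refine Finset.sum_congr rfl fun u _ => ?_
  rw [Finset.prod_mul_distrib, Finset.prod_const, Real.finsetProd_rpow _ _ fun _ _ => by positivity]
  ring

theorem IsCBCVector.worstCaseError_le {s N : ℕ} (hN : 2 ≤ N) {γ : Fin s → ℝ≥0} {g : Fin s → ℕ}
    (h : IsCBCVector N γ g) {τ : ℝ} (hτ1 : 1 ≤ τ) (hτ2 : τ < 2) :
    worstCaseError (SobolevSpace γ) (tentLatticePoint N g) ≤
      ENNReal.ofReal (cbcConst γ τ * ((N : ℝ) - 1) ^ (-τ / 2)) := by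
  have : NeZero N := ⟨by omega⟩
  have hτ0 : 0 < τ := by linarith
  have hp : 1 < 2 * (1 / τ) := by
    rw [mul_one_div, lt_div_iff₀ hτ0]
    linarith
  have hp1 : 1 / τ ≤ 1 := (div_le_one hτ0).2 hτ1
  have hα : 2 * (1 / τ) = 2 / τ := by ring
  have hM : (0 : ℝ) < N - 1 := by
    have : (2 : ℝ) ≤ N := mod_cast hN
    linarith
  have hmain := h.error_le hp hp1 le_rfl
  simp only [initial_self] at hmain
  set ζ := (riemannZeta ((2 / τ : ℝ) : ℂ)).re with hζ
  have hZ : zetaSum (1 / τ) = ENNReal.ofReal ζ := by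
    rw [zetaSum, ← ENNReal.ofReal_tsum_of_nonneg (fun h => by positivity)
      (Real.summable_nat_rpow.2 (by linarith)), tsum_rpow_eq_riemannZeta_re hp, hα]
  have hζ0 : 0 ≤ ζ := by
    rw [hζ, ← hα, ← tsum_rpow_eq_riemannZeta_re hp]
    exact tsum_nonneg fun h => by positivity
  have hfac : ∀ j, 0 ≤ 1 + 2 * ζ * (γ j : ℝ) ^ (1 / τ) := fun j => by positivity
  have hB : ∏ j, (1 + 2 * zetaSum (1 / τ) * (γ j : ℝ≥0∞) ^ (1 / τ)) =
      ENNReal.ofReal (∏ j, (1 + 2 * ζ * (γ j : ℝ) ^ (1 / τ))) := by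
    rw [ENNReal.ofReal_prod_of_nonneg fun j _ => hfac j]
    refine Finset.prod_congr rfl fun j _ => ?_
    rw [ENNReal.ofReal_add zero_le_one (by positivity), ENNReal.ofReal_mul (by positivity),
      ENNReal.ofReal_mul zero_le_two, hZ, ← ENNReal.ofReal_rpow_of_nonneg (by positivity)
      (by positivity), ENNReal.ofReal_coe_nnreal]
    simp
  rw [worstCaseError_eq_norm, cbcConst_eq]
  refine ENNReal.ofReal_le_ofReal ?_
  rw [hB, ← sobError_sq_eq γ g (NeZero.pos N),
    ENNReal.ofReal_rpow_of_nonneg (by positivity) (by positivity), ← ENNReal.ofReal_natCast,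
    ← ENNReal.ofReal_mul (by positivity), ← ENNReal.ofReal_one,
    ← ENNReal.ofReal_add (by positivity) zero_le_one,
    ENNReal.ofReal_le_ofReal_iff (Finset.prod_nonneg fun j _ => hfac j),
    Nat.cast_sub (by omega), Nat.cast_one] at hmain
  set e := ‖errorVec γ (tentLatticePoint N g)‖
  have he : 0 ≤ e := norm_nonneg _
  set B := ∏ j, (1 + 2 * ζ * (γ j : ℝ) ^ (1 / τ))
  have h1 : (e ^ 2) ^ (1 / τ) ≤ (-1 + B) / (N - 1) := by
    rw [le_div_iff₀ hM]
    linarith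
  have hB0 : 0 ≤ -1 + B := by
    have : 0 ≤ (e ^ 2) ^ (1 / τ) * ((N : ℝ) - 1) := by positivity
    linarith
  -- The exponents multiply to 2 · (1/τ) · (τ/2) = 1.
  calc e = ((e ^ 2) ^ (1 / τ)) ^ (τ / 2) := by
        rw [← Real.rpow_mul (by positivity), ← Real.rpow_natCast, ← Real.rpow_mul he]
        rw [show ((2 : ℕ) : ℝ) * (1 / τ * (τ / 2)) = 1 by push_cast; field_simp, Real.rpow_one]
    _ ≤ ((-1 + B) / (N - 1)) ^ (τ / 2) :=
        Real.rpow_le_rpow (by positivity) h1 (by positivity)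
    _ = (-1 + B) ^ (τ / 2) * ((N : ℝ) - 1) ^ (-τ / 2) := by
        rw [Real.div_rpow hB0 hM.le, neg_div, Real.rpow_neg hM.le, div_eq_mul_inv]

/-! ### Existence of an output of the algorithm -/

theorem exists_isCBCVector {s N : ℕ} (hN : 2 ≤ N) (γ : Fin s → ℝ≥0) :
    ∃ g : Fin s → ℕ, IsCBCVector N γ g := by
  induction s with
  | zero => exact ⟨fun j => j.elim0, fun j => j.elim0, fun d hd => by omega⟩
  | succ s ih =>
    obtain ⟨g, hg1, hg2⟩ := ih (Fin.init γ)
    obtain ⟨z, hz, hzmin⟩ := Finset.exists_min_image (Finset.Icc 1 (N - 1))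
      (fun z => sobError N γ (Fin.snoc g z : Fin (s + 1) → ℕ)) ⟨1, by simp; omega⟩
    refine ⟨(Fin.snoc g z : Fin (s + 1) → ℕ), fun j => ?_, fun d hd x hx => ?_⟩
    · refine Fin.lastCases ?_ (fun i => ?_) j
      · simpa using hz
      · simpa using hg1 i
    -- For d < s the condition does not see the appended component; for d = s it is the minimality
    -- of z.
    · rcases Nat.lt_or_ge d s with h | h
      · have hi : initial hd (Fin.snoc g z : Fin (s + 1) → ℕ) = initial h g := by
          funext i
          exact Fin.snoc_castSucc (α := fun _ => ℕ) z g (Fin.castLE h i)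
        rw [hi]
        exact hg2 d h x hx
      · obtain rfl : d = s := by omega
        simp only [initial_self, Fin.update_snoc_last]
        exact hzmin x hx

end TentLattice

theorem mainTheorem5 (s N : ℕ) (hN : 2 ≤ N) (γ : Fin s → ℝ≥0) (hγ : ∀ j, 0 < γ j) :
    (∃ g : Fin s → ℕ, TentLattice.IsCBCVector N γ g) ∧
    ∀ g : Fin s → ℕ, TentLattice.IsCBCVector N γ g →
      ∀ τ : ℝ, 1 ≤ τ → τ < 2 →
        TentLattice.worstCaseError (TentLattice.SobolevSpace γ)
            (TentLattice.tentLatticePoint N g) ≤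
          ENNReal.ofReal (TentLattice.cbcConst γ τ * ((N : ℝ) - 1) ^ (-τ / 2)) ∧
        TentLattice.cbcConst γ τ =
          (-1 + ∏ j, (1 + 2 * (riemannZeta ((2 / τ : ℝ) : ℂ)).re * (γ j : ℝ) ^ (1 / τ))) ^ (τ / 2) :=
  ⟨TentLattice.exists_isCBCVector hN γ, fun _ hg τ hτ1 hτ2 =>
    ⟨hg.worstCaseError_le hN hτ1 hτ2, TentLattice.cbcConst_eq γ τ⟩⟩
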